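/- All graphs are finite and simple, and $n\ge 0$ is an integer. For a graph $G$ with $n$ vertices, $\mathrm{Part}(G)\vdash n$ is the partition formed by the numbers of vertices of the connected components of $G$; $\ell(\lambda)$ is the number of parts of a partition $\lambda$; $X_G=\sum_\kappa\prod_{v\in V(G)}x_{\kappa(v)}$ is the chromatic symmetric function (sum over all proper colorings $\kappa:V(G)\to\mathbb{Z}^+$); and $$U_G(x,y)=\sum_{A\subseteq E(G)}\Big(\prod_{i=1}^{|V(G)|}x_i^{c_i(A)}\Big)(y-1)^{|A|-r(A)}$$ is the $U$-polynomial, where $c_i(A)$ is the number of components with $i$ vertices of the spanning subgraph $(V(G),A)$ and $r(A)=|V(G)|-\sum_i c_i(A)$. For a forest all exponents of $y-1$ are $0$. Write $[\lambda]U_G\in\mathbb{Q}[y]$ for the coefficient of $x_{\lambda_1}\cdots x_{\lambda_\ell}$ in $U_G$. A forest-basis is a set $B=\{X_{G_\lambda}\mid\lambda\vdash n\}$, where for each $\lambda\vdash n$ a forest $G_\lambda$ with $n$ vertices and $\mathrm{Part}(G_\lambda)=\lambda$ has been chosen. Write $X_G=\sum_{\lambda\vdash n}[\lambda]X_{G,B}\,X_{G_\lambda}$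 with $[\lambda]X_{G,B}\in\mathbb{Q}$, and for $j\ge0$ put $$X^j_{G,B}=\sum_{\ell(\lambda)\le\ell(\mathrm{Part}(G))+j}[\lambda]X_{G,B}\,X_{G_\lambda}.$$ The corner number of a forest $F$ with respect to $B$ is the integer $k\ge1$ with $X^{k-1}_{F,B}=X_{G_{\mathrm{Part}(F)}}$ but $X^{k}_{F,B}\ne X_{G_{\mathrm{Part}(F)}}$; it is $\infty$ if $X^j_{F,B}=X_{G_{\mathrm{Part}(F)}}$ for all $j\ge 0$. **Theorem.** Let $F_1$ and $F_2$ be forests with $n$ vertices such that $\mathrm{Part}(F_1)=\mathrm{Part}(F_2)=\mu$, and let $B$ be a forest-basis with $X_{F_2}\in B$. Then there is exactly one family of rational coefficients $([\lambda]X_{F_1,B})_{\lambda\vdash n}$ expressing $X_{F_1}$ in $B$, and $F_1$ has exactly one corner number $k\in\{1,2,\ldots\}\cup\{\infty\}$ with respect to $B$. For every $\lambda\vdash n$ with $\lambda\ne\mu$ and $\ell(\lambda)\le\ell(\mu)+k$ (in particular, whenever $\ell(\lambda)\le k$), $$[\lambda]X_{F_1,B}=[\lambda]U_{F_1}-[\lambda]U_{F_2}.$$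 Moreover, $[\mu]X_{F_1,B}=1$ and $[\mu]U_{F_1}-[\mu]U_{F_2}=0$. -/

import Mathlib

namespace ForestCSF

noncomputable section

universe u

/-- The chromatic symmetric function `X_G = ∑_κ ∏_v x_{κ(v)}` (sum over all proper colorings
`κ : V → ℤ⁺`), a formal power series in `x_1, x_2, …`: the coefficient of the monomial `x^d` is
the number of proper colorings `κ` with `∏_v x_{κ(v)} = x^d`. -/
def csf {V : Type u} [Fintype V] (G : SimpleGraph V) : MvPowerSeries ℕ+ ℚ :=
  fun d => (Nat.card {κ : G.Coloring ℕ+ // ∑ v, Finsupp.single (κ v) 1 = d} : ℚ)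

/-- The sets counted in `csf` are finite. -/
theorem finite_colorings {V : Type u} [Fintype V] (G : SimpleGraph V) (d : ℕ+ →₀ ℕ) :
    Finite {κ : G.Coloring ℕ+ // ∑ v, Finsupp.single (κ v) 1 = d} := by
  have key : ∀ κ : {κ : G.Coloring ℕ+ // ∑ v, Finsupp.single (κ v) 1 = d}, ∀ v,
      κ.1 v ∈ d.support := by
    rintro ⟨κ, hκ⟩ v
    rw [Finsupp.mem_support_iff]
    change d (κ v) ≠ 0
    subst hκ
    rw [Finsupp.finsetSum_apply]
    intro h
    have h2 := (Finset.sum_eq_zero_iff.mp h) v (Finset.mem_univ v)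
    simp at h2
  refine Finite.of_injective (β := V → d.support) (fun κ v => ⟨κ.1 v, key κ v⟩) ?_
  intro κ κ' h
  apply Subtype.ext
  apply RelHom.ext
  intro v
  exact congrArg Subtype.val (congrFun h v)

open Classical in
/-- The multiset of the numbers of vertices of the connected components of `G`. -/
def componentSizes {V : Type u} [Fintype V] (G : SimpleGraph V) : Multiset ℕ :=
  (Finset.univ : Finset G.ConnectedComponent).val.map fun c => c.supp.ncard

theorem componentSizes_pos {V : Type u} [Fintype V] (G : SimpleGraph V) {i : ℕ}
    (hi : i ∈ componentSizes G) : 0 < i := by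
  classical
  obtain ⟨c, -, rfl⟩ := Multiset.mem_map.mp hi
  exact (Set.ncard_pos (Set.toFinite _)).mpr c.nonempty_supp

theorem componentSizes_sum {V : Type u} [Fintype V] (G : SimpleGraph V) :
    (componentSizes G).sum = Fintype.card V := by
  classical
  have h : (componentSizes G).sum
      = ∑ c : G.ConnectedComponent, (Finset.univ.filter
          fun v => G.connectedComponentMk v = c).card := by
    refine Finset.sum_congr rfl fun c _ => ?_
    rw [← Set.ncard_coe_finset]
    congr 1
    ext v
    simp
  rw [h, ← Finset.card_univ]
  exact (Finset.card_eq_sum_card_fiberwise fun v _ => Finset.mem_coe.mpr (Finset.mem_univ _)).symm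

/-- `Part(G)`: the partition of `n = |V|` given by the component sizes of `G`. -/
def part {n : ℕ} {V : Type u} [Fintype V] (G : SimpleGraph V) (hV : Fintype.card V = n) :
    n.Partition where
  parts := componentSizes G
  parts_pos := componentSizes_pos G
  parts_sum := (componentSizes_sum G).trans hV

/-- The length `ℓ(lam)` of a partition. -/
def length {n : ℕ} (lam : n.Partition) : ℕ := Multiset.card lam.parts

open Classical in
/-- The `U`-polynomial of Noble and Welsh,
`U_G = ∑_{A ⊆ E(G)} (∏_{i=1}^{|V|} x_i^{c_i(A)}) (y - 1)^{|A| - r(A)}`, where `c_i(A)` is the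
number of components with `i` vertices of the spanning subgraph `(V, A)` and `r(A)` is `|V|` minus
the number of components of `(V, A)`.  It is a polynomial in the `x_i` over `ℚ[y]`
(`Polynomial.X` is `y`).  Both subtractions in the exponent are of a smaller number from a larger
one. -/
def uPoly {V : Type u} [Fintype V] (G : SimpleGraph V) : MvPolynomial ℕ (Polynomial ℚ) :=
  ∑ A ∈ G.edgeFinset.powerset,
    MvPolynomial.C ((Polynomial.X - 1) ^ (A.card - (Fintype.card V -
      Multiset.card (componentSizes (SimpleGraph.fromEdgeSet (A : Set (Sym2 V))))))) *
    ∏ i ∈ Finset.Icc 1 (Fintype.card V), MvPolynomial.X i ^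
      (componentSizes (SimpleGraph.fromEdgeSet (A : Set (Sym2 V)))).count i

/-- `[lam] U_G`: the coefficient in `U_G` of `x_lam = x_{lam_1} ⋯ x_{lam_l}`, a polynomial
in `y`. -/
def uCoeff {n : ℕ} {V : Type u} [Fintype V] (lam : n.Partition) (G : SimpleGraph V) :
    Polynomial ℚ :=
  (uPoly G).coeff (Multiset.toFinsupp lam.parts)

/-- The data of a chromatic-basis: a graph `G_lam` on `n` vertices with `Part(G_lam) = lam` for
every partition `lam` of `n`. -/
structure ChromaticBasis (n : ℕ) where
  graph : n.Partition → SimpleGraph (Fin n)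
  part_graph : ∀ lam, part (graph lam) (Fintype.card_fin n) = lam

namespace ChromaticBasis

variable {n : ℕ} (B : ChromaticBasis n)

/-- A forest-basis is a chromatic-basis all of whose graphs are forests. -/
def IsForestBasis : Prop := ∀ lam, (B.graph lam).IsAcyclic

/-- The chromatic-basis as a set, `{X_{G_lam} | lam ⊢ n}`. -/
def toSet : Set (MvPowerSeries ℕ+ ℚ) := Set.range fun lam => csf (B.graph lam)

/-- `c` is a family of coefficients expressing `X_G` in `B`. -/
def IsExpansion {V : Type u} [Fintype V] (G : SimpleGraph V) (c : n.Partition → ℚ) : Prop :=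
  csf G = ∑ lam, c lam • csf (B.graph lam)

open Classical in
/-- `[lam] X_{G,B}`: the coefficient of `X_{G_lam}` in the expression of `X_G` in `B` (zero if
there is no such expression). -/
def coeff {V : Type u} [Fintype V] (G : SimpleGraph V) (lam : n.Partition) : ℚ :=
  if h : ∃ c, B.IsExpansion G c then h.choose lam else 0

/-- `X^k_{G,B}`: the part of the expression of `X_G` in `B` that comes from the partitions of
length at most `ℓ(Part(G)) + k`. -/
def truncation {V : Type u} [Fintype V] (G : SimpleGraph V) (hV : Fintype.card V = n) (k : ℕ) :
    MvPowerSeries ℕ+ ℚ :=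
  ∑ lam : n.Partition with length lam ≤ length (part G hV) + k,
    B.coeff G lam • csf (B.graph lam)

/-- `k` is the corner number of the forest `F` with respect to `B`: with `F'` the member of the
basis satisfying `Part(F') = Part(F)`, one has `X^{k-1}_{F,B} = X_{F'}` but `X^k_{F,B} ≠ X_{F'}`.
The corner number is `∞` when all the `X^j_{F,B}` agree with `X_{F'}`. -/
def IsCornerNumber {V : Type u} [Fintype V] (F : SimpleGraph V) (hV : Fintype.card V = n)
    (k : ℕ∞) : Prop :=
  (∃ j : ℕ, k = ((j + 1 : ℕ) : ℕ∞) ∧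
    B.truncation F hV j = csf (B.graph (part F hV)) ∧
    B.truncation F hV (j + 1) ≠ csf (B.graph (part F hV))) ∨
  (k = ⊤ ∧ ∀ j : ℕ, B.truncation F hV j = csf (B.graph (part F hV)))

end ChromaticBasis

end

end ForestCSF

/-! ### Triangular linear systems; edge counts of forests. -/

namespace ForestCSF

/-! Let N_F(λ) be the number of edge sets of F of type λ (`edgeSubsetCount`). Every edge set A of a
forest satisfies |A| = n - ℓ(type of A). So [λ]U_F = N_F(λ) (`uCoeff_forest`), and in Stanley's
power sum expansion the sign depends only on λ (`csf_forest`). As power sums are independent,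
expanding X_F in B means solving N_F(λ) = ∑_ν N_{G_ν}(λ) c_ν (`isExpansion_iff_edgeSubsetCount`).

Deleting edges of a forest creates components, so this system is unitriangular for length and has
exactly one solution. Let e_μ be the coefficient family that is 1 at μ and 0 elsewhere. Then c - e_μ
solves the system with right side N_{F₁} - N_{G_μ}, which is the difference of U-coefficients
because X_{F₂} = X_{G_μ} (`edgeSubsetCount_eq`). Corner number k makes c - e_μ vanish in lengths
below ℓ(μ) + k, so up to length ℓ(μ) + k only the diagonal term survives (`coeff_sub_eq`). -/

open Finset in
theorem exists_equiv_of_map_univ_eq {ι κ α : Type*} [Fintype ι] [Fintype κ] {a : ι → α} {b : κ → α}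
    (h : (univ : Finset ι).val.map a = (univ : Finset κ).val.map b) :
    ∃ e : ι ≃ κ, ∀ x, b (e x) = a x := by
  classical
  have hc : ∀ i, Nonempty ({x // a x = i} ≃ {y // b y = i}) := by
    intro i
    refine Fintype.card_eq.mp ?_
    have := congrArg (Multiset.count i) h
    rw [Multiset.count_map, Multiset.count_map] at this
    rw [Fintype.card_subtype, Fintype.card_subtype]
    simpa [Finset.card_def, Finset.filter_val, eq_comm] using this
  let E := fun i => (hc i).some
  refine ⟨(Equiv.sigmaFiberEquiv a).symm.trans
    ((Equiv.sigmaCongrRight E).trans (Equiv.sigmaFiberEquiv b)), fun x => ?_⟩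
  exact (E (a x) ⟨x, rfl⟩).2

/-- A matrix that is triangular for a rank function, with nonzero diagonal, is injective. -/
theorem eq_zero_of_triangular {ι K : Type*} [Fintype ι] [Field K] (r : ι → ℕ) (M : ι → ι → K)
    (hdiag : ∀ i, M i i ≠ 0) (htri : ∀ i j, M i j ≠ 0 → i = j ∨ r j < r i) {a : ι → K} {N : ℕ}
    (ha : ∀ i, r i ≤ N → ∑ j, M i j * a j = 0) : ∀ i, r i ≤ N → a i = 0 := by
  classical
  intro i
  induction hm : r i using Nat.strong_induction_on generalizing i with
  | _ m ih =>
    intro hN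
    have h := ha i (hm ▸ hN)
    rw [Finset.sum_eq_single i] at h
    · exact (mul_eq_zero.mp h).resolve_left (hdiag i)
    · intro j _ hji
      by_cases hM : M i j = 0
      · simp [hM]
      · have hlt : r j < r i := (htri i j hM).resolve_left (Ne.symm hji)
        rw [ih (r j) (hm ▸ hlt) j rfl (by omega), mul_zero]
    · simp

/-- In finite dimension, injectivity gives surjectivity. -/
theorem exists_solution_of_triangular {ι K : Type*} [Fintype ι] [Field K] (r : ι → ℕ)
    (M : ι → ι → K) (hdiag : ∀ i, M i i ≠ 0) (htri : ∀ i j, M i j ≠ 0 → i = j ∨ r j < r i)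
    (b : ι → K) : ∃ a : ι → K, ∀ i, b i = ∑ j, M i j * a j := by
  classical
  have hinj : Function.Injective (Matrix.toLin' (Matrix.of M)) := by
    rw [← LinearMap.ker_eq_bot, LinearMap.ker_eq_bot']
    intro a ha
    funext i
    exact eq_zero_of_triangular r M hdiag htri (a := a) (N := r i)
      (fun j _ => congrFun ha j) i le_rfl
  obtain ⟨a, ha⟩ := LinearMap.injective_iff_surjective.mp hinj b
  exact ⟨a, fun i => (congrFun ha i).symm⟩

/-- The number of edges plus the number of components of a forest is the number of vertices. -/
theorem card_edgeFinset_add_card_componentSizes {V : Type*} [Fintype V] (G : SimpleGraph V)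
    [Fintype G.edgeSet] (hG : G.IsAcyclic) :
    G.edgeFinset.card + Multiset.card (componentSizes G) = Fintype.card V := by
  classical
  have hdeg : ∀ c : G.ConnectedComponent, ∀ v : c.supp, c.toSimpleGraph.degree v = G.degree v := by
    intro c v
    have hsub : G.neighborSet v ⊆ c.supp := by
      intro w hw
      have hv : G.connectedComponentMk v = c := v.2
      exact (SimpleGraph.ConnectedComponent.connectedComponentMk_eq_of_adj hw).symm.trans hv
    rw [← SimpleGraph.degree_induce_of_neighborSet_subset hsub]
    congr!
  have h1 : ∑ v, G.degree v = ∑ c : G.ConnectedComponent, ∑ v : c.supp, G.degree v := by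
    rw [← Fintype.sum_sigma' (f := fun (c : G.ConnectedComponent) (v : c.supp) => G.degree v)]
    let e : V ≃ (c : G.ConnectedComponent) × c.supp :=
      (Equiv.sigmaFiberEquiv G.connectedComponentMk).symm
    exact Fintype.sum_equiv e _ _ fun _ => rfl
  -- Each component is a tree, with one edge fewer than vertices; summing over components counts the
  -- components.
  have h2 : ∀ c : G.ConnectedComponent, ∑ v : c.supp, G.degree v + 2 = 2 * c.supp.ncard := by
    intro c
    rw [← Finset.sum_congr rfl (fun v _ => hdeg c v)]
    have h3 := (hG.isTree_connectedComponent c).card_edgeFinset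
    have h4 := c.toSimpleGraph.sum_degrees_eq_twice_card_edges
    have h5 : c.supp.ncard = Fintype.card c.supp := by
      rw [← Nat.card_coe_set_eq, Nat.card_eq_fintype_card]
    have h6 : Fintype.card c.supp = Fintype.card c := Fintype.card_congr (Equiv.refl _)
    have h7 : ∑ v : c.supp, c.toSimpleGraph.degree v = 2 * c.toSimpleGraph.edgeFinset.card := by
      convert h4
      exact Iff.rfl
    omega
  have h3 := G.sum_degrees_eq_twice_card_edges
  have h4 := componentSizes_sum G
  have h5 : (componentSizes G).sum = ∑ c : G.ConnectedComponent, c.supp.ncard := by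
    unfold componentSizes
    exact Finset.sum_congr (by ext; simp) fun _ _ => rfl
  have h6 : Multiset.card (componentSizes G) = Fintype.card G.ConnectedComponent := by
    unfold componentSizes
    rw [Multiset.card_map]
    exact Fintype.card_congr (Equiv.refl _)
  have h7 : ∑ c : G.ConnectedComponent, (∑ v : c.supp, G.degree v + 2)
      = ∑ c : G.ConnectedComponent, 2 * c.supp.ncard := Finset.sum_congr rfl fun c _ => h2 c
  rw [Finset.sum_add_distrib, ← Finset.mul_sum, ← h1, h3, ← h5, h4] at h7
  simp only [Finset.sum_const, Finset.card_univ, smul_eq_mul] at h7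
  have h9 : ∀ i1 i2 : Fintype G.edgeSet, (@SimpleGraph.edgeFinset V G i1).card =
      (@SimpleGraph.edgeFinset V G i2).card := fun i1 i2 => by congr!
  rw [h6]
  have := h9 inferInstance (SimpleGraph.fintypeEdgeSet G)
  omega

end ForestCSF

/-! ### Power sums and their linear independence. -/

namespace ForestCSF
noncomputable section

/-- `[x^d] p_m`, the coefficient of `x^d` in the power sum symmetric function indexed by the
multiset `m`: the number of ways to distribute the parts of `m` over the variables. -/
def psumCoeff (m : Multiset ℕ) (d : ℕ+ →₀ ℕ) : ℕ :=
  Nat.card {f : m.ToType → ℕ+ // ∑ x, Finsupp.single (f x) x.1 = d}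

theorem psumCoeff_map_univ {ι : Type*} [Fintype ι] (a : ι → ℕ) (d : ℕ+ →₀ ℕ) :
    psumCoeff ((Finset.univ : Finset ι).val.map a) d =
      Nat.card {f : ι → ℕ+ // ∑ x, Finsupp.single (f x) (a x) = d} := by
  obtain ⟨e, he⟩ := exists_equiv_of_map_univ_eq (a := a)
    (b := fun x : ((Finset.univ : Finset ι).val.map a).ToType => x.1)
    (Multiset.map_univ_coe _).symm
  refine (Nat.card_congr ?_).symm
  refine (Equiv.arrowCongr e (Equiv.refl ℕ+)).subtypeEquiv fun f => ?_
  rw [← Equiv.sum_comp e (fun x => Finsupp.single (e.arrowCongr (Equiv.refl ℕ+) f x) x.1)]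
  simp [he]

theorem finite_distributions {ι : Type*} [Fintype ι] (a : ι → ℕ) (ha : ∀ x, 0 < a x)
    (d : ℕ+ →₀ ℕ) : Finite {f : ι → ℕ+ // ∑ x, Finsupp.single (f x) (a x) = d} := by
  have key : ∀ f : {f : ι → ℕ+ // ∑ x, Finsupp.single (f x) (a x) = d}, ∀ x,
      f.1 x ∈ d.support := by
    rintro ⟨f, rfl⟩ x
    rw [Finsupp.mem_support_iff, Finsupp.finsetSum_apply]
    intro h
    have h2 := (Finset.sum_eq_zero_iff.mp h) x (Finset.mem_univ x)
    simp [(ha x).ne'] at h2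
  refine Finite.of_injective (β := ι → d.support) (fun f x => ⟨f.1 x, key f x⟩) ?_
  intro f g h
  exact Subtype.ext (funext fun x => congrArg Subtype.val (congrFun h x))

theorem support_sum_single {ι : Type*} [Fintype ι] {a : ι → ℕ} (ha : ∀ x, 0 < a x)
    (f : ι → ℕ+) : (∑ x, Finsupp.single (f x) (a x)).support = Finset.univ.image f := by
  ext i
  rw [Finsupp.mem_support_iff, Finsupp.finsetSum_apply, ne_eq, Finset.sum_eq_zero_iff]
  simp [Finsupp.single_apply, (ha _).ne']

theorem map_support_sum_single {ι : Type*} [Fintype ι] {a : ι → ℕ} (ha : ∀ x, 0 < a x)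
    {f : ι → ℕ+} (hf : Function.Injective f) {d : ℕ+ →₀ ℕ}
    (hd : ∑ x, Finsupp.single (f x) (a x) = d) :
    d.support.val.map d = (Finset.univ : Finset ι).val.map a := by
  subst hd
  rw [support_sum_single ha, Finset.image_val_of_injOn hf.injOn, Multiset.map_map]
  refine Multiset.map_congr rfl fun x _ => ?_
  rw [Function.comp_apply, Finsupp.finsetSum_apply, Finset.sum_eq_single x]
  · simp
  · intro y _ hy
    exact Finsupp.single_eq_of_ne (fun h => hy (hf h).symm)
  · simp

theorem exists_injective_pnat (ι : Type*) [Finite ι] : ∃ f : ι → ℕ+, Function.Injective f := by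
  obtain ⟨n, ⟨e⟩⟩ := Finite.exists_equiv_fin ι
  exact ⟨fun x => Nat.succPNat (e x), fun x y h =>
    e.injective (Fin.ext (Nat.succPNat_injective h))⟩

/-- The exponent vector with entries the parts of `m`, in some order. -/
def partsExponent (m : Multiset ℕ) : ℕ+ →₀ ℕ :=
  ∑ x : m.ToType, Finsupp.single ((exists_injective_pnat m.ToType).choose x) x.1

theorem psumCoeff_partsExponent_self {m : Multiset ℕ} (hm : ∀ i ∈ m, 0 < i) :
    psumCoeff m (partsExponent m) ≠ 0 := by
  have := finite_distributions (fun x : m.ToType => x.1) (fun x => hm _ Multiset.coe_mem)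
    (partsExponent m)
  have : Nonempty {f : m.ToType → ℕ+ // ∑ x, Finsupp.single (f x) x.1 = partsExponent m} :=
    ⟨⟨_, rfl⟩⟩
  exact Nat.card_pos.ne'

/-- A distribution of the parts of `m` hits exactly `card m'` variables. If it is injective the
exponents are the parts of `m`; otherwise parts are merged and their number drops. -/
theorem psumCoeff_partsExponent {m m' : Multiset ℕ} (hm : ∀ i ∈ m, 0 < i) (hm' : ∀ i ∈ m', 0 < i)
    (h : psumCoeff m (partsExponent m') ≠ 0) : m' = m ∨ Multiset.card m' < Multiset.card m := by
  have hpos : ∀ x : m.ToType, 0 < x.1 := fun x => hm _ Multiset.coe_mem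
  have hpos' : ∀ x : m'.ToType, 0 < x.1 := fun x => hm' _ Multiset.coe_mem
  obtain ⟨⟨⟨f, hf⟩⟩, -⟩ := Nat.card_ne_zero.mp h
  have hg := (exists_injective_pnat m'.ToType).choose_spec
  have hsupp : Finset.univ.image f =
      Finset.univ.image (exists_injective_pnat m'.ToType).choose := by
    rw [← support_sum_single hpos, ← support_sum_single hpos', hf, partsExponent]
  have hcard : (Finset.univ.image f).card = Multiset.card m' := by
    rw [hsupp, Finset.card_image_of_injective _ hg, Finset.card_univ, Multiset.card_coe]
  by_cases hinj : Function.Injective f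
  · left
    have h1 := map_support_sum_single hpos hinj hf
    have h2 := map_support_sum_single hpos' hg rfl
    exact (Multiset.map_univ_coe m').symm.trans ((h2.symm.trans h1).trans (Multiset.map_univ_coe m))
  · right
    rw [← hcard, ← Multiset.card_coe m, ← Finset.card_univ]
    refine lt_of_le_of_ne Finset.card_image_le fun hc => hinj ?_
    exact fun x y hxy => Finset.card_image_iff.mp hc (by simp) (by simp) hxy

theorem length_le {n : ℕ} (lam : n.Partition) : length lam ≤ n := by
  conv_rhs => rw [← lam.parts_sum]
  have := Multiset.card_nsmul_le_sum (s := lam.parts) (a := 1) fun i hi => lam.parts_pos hi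
  simpa [length] using this

/-- The power sum symmetric functions of degree `n` are linearly independent. -/
theorem psumCoeff_linearIndependent {n : ℕ} {a : n.Partition → ℚ}
    (h : ∀ d, ∑ lam, a lam * psumCoeff lam.parts d = 0) : a = 0 := by
  funext lam
  -- Merging parts shortens partitions, so the rank must decrease with length.
  refine eq_zero_of_triangular (fun lam => n - length lam)
    (fun nu lam : n.Partition => (psumCoeff lam.parts (partsExponent nu.parts) : ℚ))
    (fun nu => ?_) (fun nu lam hne => ?_) (N := n) (fun nu _ => ?_) lam (Nat.sub_le _ _)
  · exact_mod_cast psumCoeff_partsExponent_self fun i hi => nu.parts_pos hi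
  · rcases psumCoeff_partsExponent (fun i hi => lam.parts_pos hi) (fun i hi => nu.parts_pos hi)
      (by exact_mod_cast hne) with h | h
    · exact .inl (Nat.Partition.ext h)
    · right
      have := length_le lam
      unfold length at *
      omega
  · rw [← h (partsExponent nu.parts)]
    exact Finset.sum_congr rfl fun _ _ => mul_comm _ _

end

end ForestCSF

/-! ### Edge sets by type, Stanley's expansion and the U-polynomial. -/

namespace ForestCSF
noncomputable section

open Classical in
/-- The number of edge sets `A` of `G` such that the component sizes of `(V, A)` form `m`. -/
def edgeSubsetCount {V : Type*} [Fintype V] (G : SimpleGraph V) (m : Multiset ℕ) : ℕ :=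
  (G.edgeFinset.powerset.filter fun A : Finset (Sym2 V) =>
    componentSizes (SimpleGraph.fromEdgeSet (A : Set (Sym2 V))) = m).card

/-- Colorings constant along edges are functions on components, and a component adds its size to the
exponent of its color. -/
theorem card_monochromatic {V : Type*} [Fintype V] (H : SimpleGraph V) (d : ℕ+ →₀ ℕ) :
    Nat.card {κ : {κ : V → ℕ+ // ∑ v, Finsupp.single (κ v) 1 = d} //
      ∀ v w, H.Adj v w → κ.1 v = κ.1 w} = psumCoeff (componentSizes H) d := by
  classical
  have hcs : componentSizes H =
      (Finset.univ : Finset H.ConnectedComponent).val.map fun c => c.supp.ncard := by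
    unfold componentSizes
    congr!
  have hsum : ∀ g : H.ConnectedComponent → ℕ+,
      ∑ v, Finsupp.single (g (H.connectedComponentMk v)) 1 =
        ∑ c : H.ConnectedComponent, Finsupp.single (g c) c.supp.ncard := by
    intro g
    rw [← Finset.sum_fiberwise _ H.connectedComponentMk]
    refine Finset.sum_congr rfl fun c _ => ?_
    rw [Finset.sum_congr rfl (g := fun _ => Finsupp.single (g c) 1)
      (fun v hv => by rw [(Finset.mem_filter.mp hv).2])]
    rw [Finset.sum_const, Finsupp.smul_single, smul_eq_mul, mul_one, ← Set.ncard_coe_finset]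
    congr 2
    ext v
    simp
  have hlift : ∀ κ : V → ℕ+, (∀ v w, H.Adj v w → κ v = κ w) →
      ∀ (v w : V) (p : H.Walk v w), p.IsPath → κ v = κ w := by
    intro κ hκ v w p hp
    clear hp
    induction p with
    | nil => rfl
    | cons h p ih => exact (hκ _ _ h).trans ih
  rw [hcs, psumCoeff_map_univ]
  exact Nat.card_congr
    { toFun := fun κ => ⟨SimpleGraph.ConnectedComponent.lift κ.1.1 (hlift _ κ.2),
        (hsum _).symm.trans κ.1.2⟩
      invFun := fun g => ⟨⟨fun v => g.1 (H.connectedComponentMk v), (hsum _).trans g.2⟩,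
        fun v w h => congrArg g.1
          (SimpleGraph.ConnectedComponent.connectedComponentMk_eq_of_adj h)⟩
      left_inv := fun κ => rfl
      right_inv := fun g => Subtype.ext (funext fun c => c.ind fun v => rfl) }

open Classical in
/-- Stanley's expansion of the chromatic symmetric function in power sums. -/
theorem csf_eq_sum_powerset {V : Type*} [Fintype V] (G : SimpleGraph V) (d : ℕ+ →₀ ℕ) :
    csf G d = ∑ A ∈ G.edgeFinset.powerset, (-1 : ℚ) ^ A.card *
      psumCoeff (componentSizes (SimpleGraph.fromEdgeSet (A : Set (Sym2 V)))) d := by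
  have := finite_distributions (fun _ : V => 1) (fun _ => one_pos) d
  let S := {κ : V → ℕ+ // ∑ v, Finsupp.single (κ v) 1 = d}
  let _ : Fintype S := Fintype.ofFinite S
  -- Inclusion–exclusion over monochromatic edges: κ is proper iff `mono κ` is empty, and the
  -- alternating sum over subsets of `mono κ` detects this.
  let mono : S → Finset (Sym2 V) := fun κ => G.edgeFinset.filter fun e => (e.map κ.1).IsDiag
  have hmono : ∀ (A : Finset (Sym2 V)) (κ : S), A ⊆ G.edgeFinset →
      (A ⊆ mono κ ↔ ∀ v w, (SimpleGraph.fromEdgeSet (A : Set (Sym2 V))).Adj v w →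
        κ.1 v = κ.1 w) := by
    intro A κ hA
    constructor
    · intro h v w hvw
      rw [SimpleGraph.fromEdgeSet_adj] at hvw
      simpa [mono] using (Finset.mem_filter.mp (h (Finset.mem_coe.mp hvw.1))).2
    · intro h e he
      refine Finset.mem_filter.mpr ⟨hA he, ?_⟩
      induction e with
      | _ v w =>
        have hvw : G.Adj v w := by simpa using hA he
        simpa using h v w ((SimpleGraph.fromEdgeSet_adj _).mpr ⟨he, hvw.ne⟩)
  have hproper : ∀ κ : S, (mono κ = ∅ ↔ ∀ v w, G.Adj v w → κ.1 v ≠ κ.1 w) := by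
    intro κ
    rw [Finset.filter_eq_empty_iff]
    constructor
    · intro h v w hvw
      simpa using h (x := s(v, w)) (by simpa using hvw)
    · intro h e
      induction e with
      | _ v w => simpa using h v w
  have h1 : csf G d = ∑ κ : S, if mono κ = ∅ then (1 : ℚ) else 0 := by
    rw [Finset.sum_boole]
    refine congrArg (Nat.cast : ℕ → ℚ) ?_
    rw [← Fintype.card_subtype, ← Nat.card_eq_fintype_card]
    exact Nat.card_congr
      { toFun := fun κ => ⟨⟨κ.1, κ.2⟩, (hproper _).mpr fun v w h => κ.1.valid h⟩
        invFun := fun κ => ⟨⟨κ.1.1, fun h => (hproper _).mp κ.2 _ _ h⟩, κ.1.2⟩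
        left_inv := fun κ => rfl
        right_inv := fun κ => rfl }
  have h2 : ∀ κ : S, (if mono κ = ∅ then (1 : ℚ) else 0) =
      ∑ A ∈ G.edgeFinset.powerset, if A ⊆ mono κ then (-1 : ℚ) ^ A.card else 0 := by
    intro κ
    rw [← Finset.sum_filter]
    have h3 : (G.edgeFinset.powerset.filter fun A => A ⊆ mono κ) = (mono κ).powerset := by
      ext A
      simp only [Finset.mem_filter, Finset.mem_powerset, and_iff_right_iff_imp]
      exact fun h => h.trans (Finset.filter_subset _ _)
    rw [h3]
    have h4 := congrArg (Int.cast : ℤ → ℚ) (Finset.sum_powerset_neg_one_pow_card (x := mono κ))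
    push_cast at h4
    exact h4.symm
  rw [h1, Finset.sum_congr rfl fun κ _ => h2 κ, Finset.sum_comm]
  refine Finset.sum_congr rfl fun A hA => ?_
  rw [← Finset.sum_filter, Finset.sum_const, nsmul_eq_mul, mul_comm, ← card_monochromatic,
    ← Fintype.card_subtype, ← Nat.card_eq_fintype_card]
  congr 2
  exact Nat.card_congr (Equiv.subtypeEquivRight fun κ => hmono A κ (Finset.mem_powerset.mp hA))

section Forest

variable {n : ℕ} {V : Type*} [Fintype V]

open Classical in
theorem card_add_card_componentSizes {F : SimpleGraph V} (hF : F.IsAcyclic)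
    {A : Finset (Sym2 V)} (hA : A ⊆ F.edgeFinset) :
    A.card + Multiset.card (componentSizes (SimpleGraph.fromEdgeSet (A : Set (Sym2 V)))) =
      Fintype.card V := by
  have hle : SimpleGraph.fromEdgeSet (A : Set (Sym2 V)) ≤ F := by
    intro v w h
    simpa using hA (Finset.mem_coe.mp ((SimpleGraph.fromEdgeSet_adj _).mp h).1)
  rw [← card_edgeFinset_add_card_componentSizes _ (hF.anti hle)]
  congr 2
  ext e
  rw [SimpleGraph.mem_edgeFinset, SimpleGraph.edgeSet_fromEdgeSet]
  constructor
  · intro he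
    exact ⟨he, F.not_isDiag_of_mem_edgeSet (SimpleGraph.mem_edgeFinset.mp (hA he))⟩
  · exact fun he => he.1

open Classical in
theorem sum_powerset_eq_sum_partition (hV : Fintype.card V = n) (G : SimpleGraph V)
    (f : n.Partition → ℚ) :
    ∑ A ∈ G.edgeFinset.powerset, f (part (SimpleGraph.fromEdgeSet (A : Set (Sym2 V))) hV) =
      ∑ lam : n.Partition, edgeSubsetCount G lam.parts * f lam := by
  rw [← Finset.sum_fiberwise G.edgeFinset.powerset (fun A : Finset (Sym2 V) =>
    part (SimpleGraph.fromEdgeSet (A : Set (Sym2 V))) hV)]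
  refine Finset.sum_congr rfl fun lam _ => ?_
  rw [Finset.sum_congr rfl (g := fun _ => f lam)
    (fun A hA => by rw [(Finset.mem_filter.mp hA).2]), Finset.sum_const, nsmul_eq_mul]
  congr 2
  unfold edgeSubsetCount
  congr 1
  refine Finset.filter_congr fun A _ => ?_
  exact Nat.Partition.ext_iff

theorem csf_forest (hV : Fintype.card V = n) {F : SimpleGraph V} (hF : F.IsAcyclic)
    (d : ℕ+ →₀ ℕ) :
    csf F d = ∑ lam : n.Partition,
      (-1 : ℚ) ^ (n - length lam) * edgeSubsetCount F lam.parts * psumCoeff lam.parts d := by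
  classical
  have h := sum_powerset_eq_sum_partition hV F fun lam =>
    (-1 : ℚ) ^ (n - length lam) * psumCoeff lam.parts d
  rw [csf_eq_sum_powerset]
  refine Eq.trans (Finset.sum_congr rfl fun A hA => ?_) (h.trans ?_)
  · have := card_add_card_componentSizes hF (Finset.mem_powerset.mp hA)
    rw [hV] at this
    have hlen : n - length (part (SimpleGraph.fromEdgeSet (A : Set (Sym2 V))) hV) = A.card := by
      change n - Multiset.card (componentSizes _) = _
      omega
    rw [hlen]
    rfl
  · exact Finset.sum_congr rfl fun _ _ => by ring

theorem edgeSubsetCount_self (hV : Fintype.card V = n) {F : SimpleGraph V} (hF : F.IsAcyclic) :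
    edgeSubsetCount F (part F hV).parts = 1 := by
  classical
  unfold edgeSubsetCount
  rw [Finset.card_eq_one]
  refine ⟨F.edgeFinset, ?_⟩
  ext A
  rw [Finset.mem_filter, Finset.mem_powerset, Finset.mem_singleton]
  constructor
  · rintro ⟨hA, h⟩
    have h1 := card_add_card_componentSizes hF hA
    have h2 := card_edgeFinset_add_card_componentSizes F hF
    rw [h] at h1
    change _ + Multiset.card (componentSizes F) = _ at h1
    exact Finset.eq_of_subset_of_card_le hA (by omega)
  · rintro rfl
    refine ⟨subset_rfl, ?_⟩
    rw [SimpleGraph.coe_edgeFinset, SimpleGraph.fromEdgeSet_edgeSet]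
    rfl

/-- A proper subset of the edges of a forest leaves strictly more components. -/
theorem edgeSubsetCount_triangular (hV : Fintype.card V = n) {F : SimpleGraph V}
    (hF : F.IsAcyclic) {lam : n.Partition} (h : edgeSubsetCount F lam.parts ≠ 0) :
    lam = part F hV ∨ length (part F hV) < length lam := by
  classical
  unfold edgeSubsetCount at h
  obtain ⟨A, hA⟩ := Finset.card_ne_zero.mp h
  rw [Finset.mem_filter, Finset.mem_powerset] at hA
  have h1 := card_add_card_componentSizes hF hA.1
  have h2 := card_edgeFinset_add_card_componentSizes F hF
  rcases hA.1.eq_or_ssubset with rfl | hlt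
  · left
    refine Nat.Partition.ext (hA.2.symm.trans ?_)
    rw [SimpleGraph.coe_edgeFinset, SimpleGraph.fromEdgeSet_edgeSet]
    rfl
  · right
    have h3 := Finset.card_lt_card hlt
    change Multiset.card (componentSizes F) < Multiset.card lam.parts
    rw [hA.2] at h1
    omega

theorem uCoeff_forest (hV : Fintype.card V = n) {F : SimpleGraph V} (hF : F.IsAcyclic)
    (lam : n.Partition) : uCoeff lam F = Polynomial.C (edgeSubsetCount F lam.parts : ℚ) := by
  classical
  unfold uCoeff uPoly
  rw [MvPolynomial.coeff_sum]
  have key : ∀ A ∈ F.edgeFinset.powerset, MvPolynomial.coeff (Multiset.toFinsupp lam.parts)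
      (MvPolynomial.C ((Polynomial.X - 1 : Polynomial ℚ) ^ (A.card - (Fintype.card V -
        Multiset.card (componentSizes (SimpleGraph.fromEdgeSet (A : Set (Sym2 V))))))) *
      ∏ i ∈ Finset.Icc 1 (Fintype.card V), MvPolynomial.X i ^
        (componentSizes (SimpleGraph.fromEdgeSet (A : Set (Sym2 V)))).count i) =
      if componentSizes (SimpleGraph.fromEdgeSet (A : Set (Sym2 V))) = lam.parts
        then 1 else 0 := by
    intro A hA
    have h1 := card_add_card_componentSizes hF (Finset.mem_powerset.mp hA)
    generalize hH : SimpleGraph.fromEdgeSet (A : Set (Sym2 V)) = H at *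
    have hsub : (Multiset.toFinsupp (componentSizes H)).support ⊆
        Finset.Icc 1 (Fintype.card V) := by
      intro i hi
      rw [Multiset.toFinsupp_support, Multiset.mem_toFinset] at hi
      rw [Finset.mem_Icc, ← componentSizes_sum H]
      exact ⟨componentSizes_pos H hi, Multiset.le_sum_of_mem hi⟩
    have hprod : ∏ i ∈ Finset.Icc 1 (Fintype.card V),
        (MvPolynomial.X i : MvPolynomial ℕ (Polynomial ℚ)) ^ (componentSizes H).count i =
        MvPolynomial.monomial (Multiset.toFinsupp (componentSizes H)) 1 := by
      rw [← MvPolynomial.prod_X_pow_eq_monomial]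
      refine (Finset.prod_subset hsub fun i _ hi => ?_).symm
      rw [Finsupp.notMem_support_iff] at hi
      rw [← Multiset.toFinsupp_apply, hi, pow_zero]
    rw [hprod, MvPolynomial.coeff_C_mul, MvPolynomial.coeff_monomial,
      show A.card - (Fintype.card V - Multiset.card (componentSizes H)) = 0 by omega,
      pow_zero, one_mul]
    simp only [EmbeddingLike.apply_eq_iff_eq]
  refine (Finset.sum_congr ?_ key).trans ?_
  · congr!
  · rw [Finset.sum_boole]
    unfold edgeSubsetCount
    simp

end Forest

end

end ForestCSF

/-! ### Expansions in a forest-basis and the corner number. -/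

namespace ForestCSF
noncomputable section

section Expansion

variable {n : ℕ}

/-- An expansion of the chromatic symmetric function of a forest in a forest-basis amounts to a
linear relation between the numbers of edge subsets of each type. -/
theorem isExpansion_iff_edgeSubsetCount {V : Type*} [Fintype V]
    (hV : Fintype.card V = n) {F : SimpleGraph V} (hF : F.IsAcyclic)
    {B : ChromaticBasis n} (hB : B.IsForestBasis) (c : n.Partition → ℚ) :
    B.IsExpansion F c ↔ ∀ lam : n.Partition, (edgeSubsetCount F lam.parts : ℚ) =
      ∑ nu, (edgeSubsetCount (B.graph nu) lam.parts : ℚ) * c nu := by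
  have hdiff : ∀ d, csf F d - (∑ nu, c nu • csf (B.graph nu)) d =
      ∑ lam : n.Partition, ((-1 : ℚ) ^ (n - length lam) * (edgeSubsetCount F lam.parts -
        ∑ nu, (edgeSubsetCount (B.graph nu) lam.parts : ℚ) * c nu)) *
          psumCoeff lam.parts d := by
    intro d
    have h1 : (∑ nu, c nu • csf (B.graph nu)) d = ∑ nu, c nu * csf (B.graph nu) d :=
      Finset.sum_apply d _ _
    have h2 : ∀ nu, csf (B.graph nu) d = _ := fun nu => csf_forest (Fintype.card_fin n) (hB nu) d
    simp only [h1, csf_forest hV hF, h2, mul_sub, sub_mul, Finset.sum_sub_distrib, Finset.mul_sum,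
      Finset.sum_mul]
    rw [Finset.sum_comm]
    congr 1
    refine Finset.sum_congr rfl fun lam _ => Finset.sum_congr rfl fun nu _ => ?_
    ring
  constructor
  · intro h lam
    have h0 := congrFun (psumCoeff_linearIndependent fun d => by
      rw [← hdiff d, sub_eq_zero]
      exact congrFun h d) lam
    rcases mul_eq_zero.mp h0 with h0 | h0
    · exact absurd h0 (pow_ne_zero _ (by norm_num))
    · exact sub_eq_zero.mp h0
  · intro h
    refine funext fun d => ?_
    rw [← sub_eq_zero]
    refine (hdiff d).trans (Finset.sum_eq_zero fun lam _ => ?_)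
    rw [← h lam, sub_self, mul_zero, zero_mul]

namespace ChromaticBasis

theorem IsForestBasis.diag {B : ChromaticBasis n} (hB : B.IsForestBasis) (lam : n.Partition) :
    (edgeSubsetCount (B.graph lam) lam.parts : ℚ) ≠ 0 := by
  have := edgeSubsetCount_self (Fintype.card_fin n) (hB lam)
  rw [B.part_graph] at this
  simp [this]

theorem IsForestBasis.triangular {B : ChromaticBasis n} (hB : B.IsForestBasis)
    (lam nu : n.Partition) (h : (edgeSubsetCount (B.graph nu) lam.parts : ℚ) ≠ 0) :
    lam = nu ∨ length nu < length lam := by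
  have := edgeSubsetCount_triangular (Fintype.card_fin n) (hB nu) (lam := lam)
    (by exact_mod_cast h)
  rwa [B.part_graph] at this

variable {V : Type*} [Fintype V]

theorem IsExpansion.unique {B : ChromaticBasis n} (hB : B.IsForestBasis)
    (hV : Fintype.card V = n) {F : SimpleGraph V} (hF : F.IsAcyclic) {c c' : n.Partition → ℚ}
    (hc : B.IsExpansion F c) (hc' : B.IsExpansion F c') : c = c' := by
  rw [isExpansion_iff_edgeSubsetCount hV hF hB] at hc hc'
  funext lam
  refine sub_eq_zero.mp (eq_zero_of_triangular length _ hB.diag hB.triangular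
    (a := fun nu => c nu - c' nu) (N := n) (fun nu _ => ?_) lam (length_le lam))
  simp only [mul_sub, Finset.sum_sub_distrib]
  rw [← hc nu, ← hc' nu, sub_self]

theorem IsForestBasis.isExpansion_iff {B : ChromaticBasis n} (hB : B.IsForestBasis)
    (hV : Fintype.card V = n) {F : SimpleGraph V} (hF : F.IsAcyclic) (c : n.Partition → ℚ) :
    B.IsExpansion F c ↔ c = B.coeff F := by
  have hex : ∃ c, B.IsExpansion F c := by
    obtain ⟨c, hc⟩ := exists_solution_of_triangular length _ hB.diag hB.triangular
      fun lam => (edgeSubsetCount F lam.parts : ℚ)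
    exact ⟨c, (isExpansion_iff_edgeSubsetCount hV hF hB c).mpr hc⟩
  have hcoeff : B.IsExpansion F (B.coeff F) := by
    -- Since an expansion exists, the default value 0 in `coeff` is not taken.
    have h : B.coeff F = hex.choose := funext fun lam => dif_pos hex
    rw [h]
    exact hex.choose_spec
  exact ⟨fun h => h.unique hB hV hF hcoeff, fun h => h ▸ hcoeff⟩

open Classical in
theorem isExpansion_single {B : ChromaticBasis n} {F : SimpleGraph V} {mu : n.Partition}
    (h : csf F = csf (B.graph mu)) : B.IsExpansion F (Pi.single mu 1) := by
  unfold IsExpansion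
  rw [h, Finset.sum_eq_single mu]
  · simp
  · intro nu _ hnu
    simp [hnu]
  · simp

open Classical in
/-- The truncation is `X_{G_mu}` exactly if the coefficients in its range are those of `X_{G_mu}`. -/
theorem IsForestBasis.truncation_eq_iff {B : ChromaticBasis n} (hB : B.IsForestBasis)
    (hV : Fintype.card V = n) (F : SimpleGraph V) (j : ℕ) :
    B.truncation F hV j = csf (B.graph (part F hV)) ↔
      ∀ lam, length lam ≤ length (part F hV) + j →
        B.coeff F lam = (Pi.single (part F hV) 1 : n.Partition → ℚ) lam := by
  have htrunc : B.truncation F hV j = ∑ lam,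
      (if length lam ≤ length (part F hV) + j then B.coeff F lam else 0) • csf (B.graph lam) := by
    unfold truncation
    rw [Finset.sum_filter]
    refine Finset.sum_congr (by congr!) fun lam _ => ?_
    split_ifs <;> simp
  rw [htrunc, eq_comm]
  constructor
  · intro h lam hlam
    -- The truncation is read as an expansion of the basis forest itself, so uniqueness applies.
    have := congrFun (IsExpansion.unique hB (Fintype.card_fin n) (hB _) h
      (isExpansion_single rfl)) lam
    simpa [hlam] using this
  · intro h
    refine (isExpansion_single rfl).trans (Finset.sum_congr rfl fun lam _ => ?_)
    split_ifs with hlam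
    · rw [h lam hlam]
    · rw [Pi.single_eq_of_ne (fun hl => hlam (by rw [hl]; omega))]

open Classical in
/-- The difference of the expansions of two forests of the same type, in terms of the numbers of
edge subsets. -/
theorem IsForestBasis.sum_coeff_sub {B : ChromaticBasis n} (hB : B.IsForestBasis)
    (hV : Fintype.card V = n) {F : SimpleGraph V} (hF : F.IsAcyclic) (mu lam : n.Partition) :
    ∑ nu, (edgeSubsetCount (B.graph nu) lam.parts : ℚ) *
        (B.coeff F nu - (Pi.single mu 1 : n.Partition → ℚ) nu) =
      edgeSubsetCount F lam.parts - edgeSubsetCount (B.graph mu) lam.parts := by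
  have h := (isExpansion_iff_edgeSubsetCount hV hF hB _).mp ((hB.isExpansion_iff hV hF _).mpr rfl) lam
  simp only [mul_sub, Finset.sum_sub_distrib]
  rw [← h]
  simp [Pi.single_apply]

theorem IsForestBasis.edgeSubsetCount_eq {B : ChromaticBasis n} (hB : B.IsForestBasis)
    (hV : Fintype.card V = n) {F : SimpleGraph V} (hF : F.IsAcyclic) (hFB : csf F ∈ B.toSet)
    (lam : n.Partition) :
    edgeSubsetCount F lam.parts = edgeSubsetCount (B.graph (part F hV)) lam.parts := by
  classical
  obtain ⟨nu, hnu⟩ := hFB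
  have h : ∀ lam : n.Partition,
      edgeSubsetCount F lam.parts = edgeSubsetCount (B.graph nu) lam.parts := by
    intro lam
    have := (isExpansion_iff_edgeSubsetCount hV hF hB _).mp (isExpansion_single hnu.symm) lam
    simpa [Pi.single_apply] using this
  -- The index `nu` need not be `part F hV` a priori; triangularity used in both directions forces
  -- it.
  have h1 := hB.triangular (part F hV) nu (by rw [← h, edgeSubsetCount_self hV hF]; norm_num)
  have h2 := edgeSubsetCount_triangular hV hF (lam := nu)
    (by rw [h]; exact_mod_cast hB.diag nu)
  have h3 : part F hV = nu := by
    rcases h1 with h1 | h1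
    · exact h1
    · rcases h2 with h2 | h2
      · exact h2.symm
      · omega
  rw [h3]
  exact h lam

open Classical in
/-- Below the rank where two expansions first differ, the triangular system is diagonal. -/
theorem IsForestBasis.coeff_sub_eq {B : ChromaticBasis n} (hB : B.IsForestBasis)
    (hV : Fintype.card V = n) {F : SimpleGraph V} (hF : F.IsAcyclic) {mu lam : n.Partition}
    (h : ∀ nu, length nu < length lam → B.coeff F nu = (Pi.single mu 1 : n.Partition → ℚ) nu) :
    B.coeff F lam - (Pi.single mu 1 : n.Partition → ℚ) lam =
      edgeSubsetCount F lam.parts - edgeSubsetCount (B.graph mu) lam.parts := by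
  rw [← hB.sum_coeff_sub hV hF, Finset.sum_eq_single lam]
  · have := edgeSubsetCount_self (Fintype.card_fin n) (hB lam)
    rw [B.part_graph] at this
    rw [this, Nat.cast_one, one_mul]
  · intro nu _ hnu
    by_cases h0 : (edgeSubsetCount (B.graph nu) lam.parts : ℚ) = 0
    · rw [h0, zero_mul]
    · rw [h nu ((hB.triangular lam nu h0).resolve_left hnu.symm), sub_self, mul_zero]
  · simp

/-- In lengths at most ℓ(Part(F)) both forests have one edge set of type Part(F) and none of any
other type, so the system there is homogeneous. -/
theorem IsForestBasis.truncation_zero {B : ChromaticBasis n} (hB : B.IsForestBasis)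
    (hV : Fintype.card V = n) {F : SimpleGraph V} (hF : F.IsAcyclic) :
    B.truncation F hV 0 = csf (B.graph (part F hV)) := by
  classical
  rw [hB.truncation_eq_iff]
  intro lam hlam
  refine sub_eq_zero.mp (eq_zero_of_triangular length _ hB.diag hB.triangular
    (a := fun nu => B.coeff F nu - (Pi.single (part F hV) 1 : n.Partition → ℚ) nu)
    (fun nu hnu => ?_) lam hlam)
  rw [hB.sum_coeff_sub hV hF]
  by_cases h : nu = part F hV
  · subst h
    have := edgeSubsetCount_self (Fintype.card_fin n) (hB (part F hV))
    rw [B.part_graph] at this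
    rw [edgeSubsetCount_self hV hF, this, sub_self]
  · have h1 : edgeSubsetCount F nu.parts = 0 := by
      by_contra h0
      rcases edgeSubsetCount_triangular hV hF h0 with h2 | h2
      · exact h h2
      · omega
    have h2 : (edgeSubsetCount (B.graph (part F hV)) nu.parts : ℚ) = 0 := by
      by_contra h0
      rcases hB.triangular _ _ h0 with h2 | h2
      · exact h h2
      · omega
    rw [h1, h2, Nat.cast_zero, sub_zero]

/-- Agreement of the truncations is inherited by smaller `j` and holds at 0, so the corner number is
the first failing `j`, or ∞. -/
theorem IsForestBasis.existsUnique_isCornerNumber {B : ChromaticBasis n} (hB : B.IsForestBasis)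
    (hV : Fintype.card V = n) {F : SimpleGraph V} (hF : F.IsAcyclic) :
    ∃! k : ℕ∞, B.IsCornerNumber F hV k := by
  classical
  have hanti : ∀ i j, i ≤ j → B.truncation F hV j = csf (B.graph (part F hV)) →
      B.truncation F hV i = csf (B.graph (part F hV)) := by
    intro i j hij h
    rw [hB.truncation_eq_iff] at h ⊢
    exact fun lam hlam => h lam (by omega)
  by_cases hall : ∀ j, B.truncation F hV j = csf (B.graph (part F hV))
  · refine ⟨⊤, .inr ⟨rfl, hall⟩, ?_⟩
    rintro k (⟨j, -, -, hj⟩ | ⟨rfl, -⟩)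
    · exact absurd (hall _) hj
    · rfl
  · rw [not_forall] at hall
    have hne : Nat.find hall ≠ 0 := by
      intro h0
      have := Nat.find_spec hall
      rw [h0] at this
      exact this (hB.truncation_zero hV hF)
    obtain ⟨j, hj⟩ := Nat.exists_eq_succ_of_ne_zero hne
    have hj1 : B.truncation F hV j = csf (B.graph (part F hV)) :=
      not_not.mp (Nat.find_min hall (by omega))
    have hj2 : B.truncation F hV (j + 1) ≠ csf (B.graph (part F hV)) := by
      rw [← Nat.succ_eq_add_one, ← hj]
      exact Nat.find_spec hall
    refine ⟨((j + 1 : ℕ) : ℕ∞), .inl ⟨j, rfl, hj1, hj2⟩, ?_⟩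
    rintro k (⟨i, rfl, hi1, hi2⟩ | ⟨rfl, hk⟩)
    · rcases lt_trichotomy i j with h | rfl | h
      · exact absurd (hanti (i + 1) j h hj1) hi2
      · rfl
      · exact absurd (hanti (j + 1) i h hi1) hj2
    · exact absurd (hk _) hj2

end ChromaticBasis

end Expansion

end

end ForestCSF

theorem mainTheorem2 {n : ℕ} {V₁ V₂ : Type*} [Fintype V₁] [Fintype V₂]
    (hV₁ : Fintype.card V₁ = n) (hV₂ : Fintype.card V₂ = n)
    (F₁ : SimpleGraph V₁) (F₂ : SimpleGraph V₂)
    (hF₁ : F₁.IsAcyclic) (hF₂ : F₂.IsAcyclic)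
    (μ : n.Partition)
    (hμ₁ : ForestCSF.part F₁ hV₁ = μ) (hμ₂ : ForestCSF.part F₂ hV₂ = μ)
    (B : ForestCSF.ChromaticBasis n) (hB : B.IsForestBasis)
    (hF₂B : ForestCSF.csf F₂ ∈ B.toSet) :
    (∀ c : n.Partition → ℚ, B.IsExpansion F₁ c ↔ c = B.coeff F₁) ∧
    (∃! k : ℕ∞, B.IsCornerNumber F₁ hV₁ k) ∧
    (∀ k : ℕ∞, B.IsCornerNumber F₁ hV₁ k →
      ∀ lam : n.Partition, lam ≠ μ →
        (ForestCSF.length lam : ℕ∞) ≤ (ForestCSF.length μ : ℕ∞) + k →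
        Polynomial.C (B.coeff F₁ lam) =
          ForestCSF.uCoeff lam F₁ - ForestCSF.uCoeff lam F₂) ∧
    B.coeff F₁ μ = 1 ∧
    ForestCSF.uCoeff μ F₁ - ForestCSF.uCoeff μ F₂ = 0 := by
  classical
  refine ⟨hB.isExpansion_iff hV₁ hF₁, hB.existsUnique_isCornerNumber hV₁ hF₁, ?_, ?_, ?_⟩
  · intro k hk lam hlam hle
    -- For k = j + 1 the strict inequality puts `nu` in the range of truncation j; for k = ∞,
    -- truncation at `length nu` is enough.
    have hbelow : ∀ nu, ForestCSF.length nu < ForestCSF.length lam →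
        B.coeff F₁ nu = (Pi.single μ 1 : n.Partition → ℚ) nu := by
      intro nu hnu
      rcases hk with ⟨j, rfl, hj, -⟩ | ⟨-, hk⟩
      · have h := (hB.truncation_eq_iff hV₁ F₁ j).mp hj
        rw [hμ₁] at h
        have hle' : ForestCSF.length lam ≤ ForestCSF.length μ + (j + 1) := by exact_mod_cast hle
        exact h nu (by omega)
      · have h := (hB.truncation_eq_iff hV₁ F₁ (ForestCSF.length nu)).mp (hk _)
        rw [hμ₁] at h
        exact h nu (by omega)
    have h := hB.coeff_sub_eq hV₁ hF₁ hbelow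
    rw [Pi.single_eq_of_ne hlam, sub_zero] at h
    rw [ForestCSF.uCoeff_forest hV₁ hF₁, ForestCSF.uCoeff_forest hV₂ hF₂, h,
      hB.edgeSubsetCount_eq hV₂ hF₂ hF₂B, hμ₂, Polynomial.C_sub]
  · have h := (hB.truncation_eq_iff hV₁ F₁ 0).mp (hB.truncation_zero hV₁ hF₁) μ (by rw [hμ₁]; simp)
    rw [h, hμ₁, Pi.single_eq_same]
  · have h₁ := ForestCSF.edgeSubsetCount_self hV₁ hF₁
    have h₂ := ForestCSF.edgeSubsetCount_self hV₂ hF₂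
    rw [hμ₁] at h₁
    rw [hμ₂] at h₂
    rw [ForestCSF.uCoeff_forest hV₁ hF₁, ForestCSF.uCoeff_forest hV₂ hF₂, h₁, h₂, sub_self]
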